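/- Notation. Let $n\ge 1$. For $N>n$ let $K_N$ be the complete graph on the vertex set $[N]=\{1,\dots,N\}$ with nonnegative real edge weights $w$; the vertices in $[n]$ are the terminals and $N$ is the sink. For $W\subseteq[N-1]$ let $\|C(W)\|$ be the total weight of the edges with exactly one end in $W$, and for $\varnothing\ne I\subseteq[n]$ let $S_I=\min\{\|C(W)\| : W\subseteq[N-1],\ W\cap[n]=I\}$. The holographic entropy cone $H_n\subset\mathbb R^{2^n-1}$ is the set of all vectors $(S_I)_{\varnothing\ne I\subseteq[n]}$ arising in this way from some $N>n$ and some weights on $K_N$. An inequality $qS\ge 0$, $q\in\mathbb R^{2^n-1}$, is valid for $H_n$ if all $S\in H_n$ satisfy it; it is a facet of $H_n$ if, moreover, $\{S\in H_n: qS=0\}$ has dimension $\dim H_n-1$. Write $[n;N]=[n]\cup\{N\}$ and, for $\varnothing\ne A\subsetneq[n;N]$ with $N\in A$, set $S_A=S_{[n;N]\setminus A}$. A subadditivity inequality (SA) over $H_n$ is $S_I+S_J\ge S_{I\cup J}$ with $I,J\subset[n;N]$ disjoint and non-empty and $I\cup J\ne[n;N]$. A monogamy inequality (MMI) over $H_n$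 is $S_{I\cup J}+S_{I\cup K}+S_{J\cup K}\ge S_I+S_J+S_K+S_{I\cup J\cup K}$ with $I,J,K\subset[n;N]$ pairwise disjoint and non-empty and $I\cup J\cup K\ne[n;N]$. A zero-lift to $H_n$ of an inequality over $H_m$, written in terms of the $S_I$ with $\varnothing\neq I\subseteq[m]$, is obtained by choosing for each terminal $i$ that appears in it a non-empty set $I_i\subseteq[n]$, these sets being pairwise disjoint, and replacing each $S_I$ that appears in it by $S_{\bigcup_{i\in I}I_i}$. Proposition. Let $n\ge2$ and let $q'S\ge0$ be a zero-lift to $H_n$ of a subadditivity inequality over $H_m$, for some $m$. Then $q'S\ge0$ is a facet of $H_n$ if and only if, under the identification $S_{[n;N]\setminus I}=S_I$, it is an inequality $S_i+S_j\ge S_{ij}$ with $i\ne j$ in $[n;N]$. If it is not of this form, then there are pairwise disjoint non-empty $I,J,K\subset[n;N]$ with $I\cup J\cup K\ne[n;N]$ such that $q'S\ge0$ is the sum of the SA inequality for $(I,J)$, the MMI inequality for $(I,J,K)$ and the SA inequality for $(I,K)$, all three of which are valid for $H_n$. -/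

import Mathlib

open scoped NNReal

namespace HolographicEntropy

/-- The index set of `S`-vectors: the non-empty subsets of the set `[n]` of terminals
(there are `2 ^ n - 1` of them). -/
abbrev TerminalSet (n : ℕ) : Type := {I : Finset (Fin n) // I.Nonempty}

/-- The space `ℝ ^ (2 ^ n - 1)` in which the `S`-vectors live; also the space of coefficient
vectors `q` of linear inequalities `q S ≥ 0`. -/
abbrev SVec (n : ℕ) : Type := TerminalSet n → ℝ

/-- The total weight of the cut `C(W)` in a weighted complete graph on the vertices `Fin N`:
every edge with one end in `W` and the other outside `W` is counted exactly once.
(The values of `w` on the diagonal of `Sym2` are not edges and are never used.) -/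
def cutWeight {N : ℕ} (w : Sym2 (Fin N) → ℝ≥0) (W : Finset (Fin N)) : ℝ :=
  ∑ i ∈ W, ∑ j ∈ Wᶜ, (w s(i, j) : ℝ)

/-- In the complete graph on the `k + 1` vertices `Fin (k + 1)`, with `n ≤ k`, the terminals are
the first `n` vertices and the sink is the last vertex. The set `W` is a cut for the set `I` of
terminals if it does not contain the sink and contains precisely the terminals in `I`. -/
def IsCutFor {n k : ℕ} (h : n ≤ k) (W : Finset (Fin (k + 1))) (I : Finset (Fin n)) : Prop :=
  Fin.last k ∉ W ∧ ∀ i : Fin n, (Fin.castLE h i).castSucc ∈ W ↔ i ∈ I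

/-- `w` realizes `S`: every entry `S_I` is the minimum weight of a cut for `I`. -/
def Realizes {n k : ℕ} (h : n ≤ k) (w : Sym2 (Fin (k + 1)) → ℝ≥0) (S : SVec n) : Prop :=
  ∀ I : TerminalSet n, IsLeast (cutWeight w '' {W | IsCutFor h W I.1}) (S I)

/-- The holographic entropy cone `H_n`: all `S`-vectors realized by some nonnegatively weighted
complete graph `K_N`, `N = k + 1 > n`. -/
def holographicCone (n : ℕ) : Set (SVec n) :=
  {S | ∃ (k : ℕ) (h : n ≤ k) (w : Sym2 (Fin (k + 1)) → ℝ≥0), Realizes h w S}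

/-- The inequality `q S ≥ 0` is valid for `H_n`. -/
def IsValid {n : ℕ} (q : SVec n) : Prop :=
  ∀ S ∈ holographicCone n, 0 ≤ q ⬝ᵥ S

/-- The inequality `q S ≥ 0` defines a facet of `H_n`: it is valid, and its face
`{S ∈ H_n | q S = 0}` has dimension one less than `H_n`. (Both sets are cones containing `0`,
so their dimensions are those of their linear spans.) -/
def IsFacet {n : ℕ} (q : SVec n) : Prop :=
  IsValid q ∧
    Module.finrank ℝ (Submodule.span ℝ {S | S ∈ holographicCone n ∧ q ⬝ᵥ S = 0}) + 1 =
      Module.finrank ℝ (Submodule.span ℝ (holographicCone n))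

/-- The set `[n; N]` of extended terminals: `some i` is the terminal `i`, `none` is the sink. -/
abbrev ExtTerminal (n : ℕ) : Type := Option (Fin n)

/-- The set of terminals by which the set `A` of extended terminals is represented under the
identification `S_{[n; N] \ A} = S_A`: `A` itself if the sink is not in `A`, and the complement of
`A` in `[n; N]` otherwise. -/
def representative {n : ℕ} (A : Finset (ExtTerminal n)) : Finset (Fin n) :=
  if none ∈ A then (Finset.eraseNone A)ᶜ else Finset.eraseNone A

/-- The coefficient vector of the linear form `S ↦ S_A`, for a set `A` of extended terminals
(it is `0` for `A = ∅` and `A = [n; N]`). -/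
def entry {n : ℕ} (A : Finset (ExtTerminal n)) : SVec n :=
  fun I => if I.1 = representative A then 1 else 0

/-- The coefficient vector of `S_I + S_J ≥ S_{I ∪ J}`. -/
def saVec {n : ℕ} (I J : Finset (ExtTerminal n)) : SVec n :=
  entry I + entry J - entry (I ∪ J)

/-- The coefficient vector of
`S_{I ∪ J} + S_{I ∪ K} + S_{J ∪ K} ≥ S_I + S_J + S_K + S_{I ∪ J ∪ K}`. -/
def mmiVec {n : ℕ} (I J K : Finset (ExtTerminal n)) : SVec n :=
  entry (I ∪ J) + entry (I ∪ K) + entry (J ∪ K)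
    - entry I - entry J - entry K - entry (I ∪ J ∪ K)

/-- Subadditivity inequalities over `H_n`: `S_I + S_J ≥ S_{I ∪ J}` for disjoint non-empty sets
`I`, `J` of extended terminals with `I ∪ J ≠ [n; N]`. If the sink is in `I` or `J`, these are the
Araki-Lieb inequalities. -/
def IsSubadditivity {n : ℕ} (q : SVec n) : Prop :=
  ∃ I J : Finset (ExtTerminal n), I.Nonempty ∧ J.Nonempty ∧ Disjoint I J ∧
    I ∪ J ≠ Finset.univ ∧ q = saVec I J

/-- Singleton form: `S_i + S_j ≥ S_{ij}` with `i ≠ j` in `[n; N]`. -/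
def IsSingletonSA {n : ℕ} (q : SVec n) : Prop :=
  ∃ i j : ExtTerminal n, i ≠ j ∧ q = saVec {i} {j}

/-- The terminals appearing in the inequality `q S ≥ 0`. -/
def appearing {n : ℕ} (q : SVec n) : Set (Fin n) :=
  {i | ∃ I : TerminalSet n, i ∈ I.1 ∧ q I ≠ 0}

/-- Replace each terminal `i` in every `S_I` of `q S ≥ 0` by the set `F i`. -/
def substitute {m n : ℕ} (F : Fin m → Finset (Fin n)) (q : SVec m) : SVec n :=
  fun I' => ∑ I : TerminalSet m, if I.1.biUnion F = I'.1 then q I else 0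

/-- `q'` is a zero-lift of `q`: it arises by replacing the terminals that appear in `q` by
non-empty, pairwise disjoint sets of terminals. -/
def IsZeroLift {m n : ℕ} (q : SVec m) (q' : SVec n) : Prop :=
  ∃ F : Fin m → Finset (Fin n), (∀ i ∈ appearing q, (F i).Nonempty) ∧
    (appearing q).PairwiseDisjoint F ∧ q' = substitute F q

end HolographicEntropy

/-! A zero-lift of a subadditivity inequality is again a subadditivity inequality: collapsing each
substituted set to its terminal and everything else to the sink gives a map `[n; N] → [m; N]`, and
the blocks of the lifted inequality are the preimages of the original blocks
(`IsSubadditivity.of_isZeroLift`). By the identification `S_{[n; N] \ A} = S_A`, every `S_A` is a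
minimum over cuts which may contain the sink (`Realizes.isLeast_entry`), so subadditivity and
monogamy need no case distinction on the position of the sink: the first follows by taking unions of
minimum cuts, the second from a distance-non-increasing map `{0,1}³ → {0,1}⁴`
(`cutWeight_contraction`).

If one side of the subadditivity inequality has two elements, split it as `J ∪ K`; then
`S_I + S_{J ∪ K} ≥ S_{I ∪ J ∪ K}` is the sum of three valid inequalities (`saVec_union`). Its face
lies in the face of the first of them, which is not a multiple of it, so its dimension is too small
for a facet (`not_isFacet_of_eq_add`).

For the converse, take the star graph with unit edges from a single bulk vertex to a set `T` of
extended terminals; it has `S_A = min |T ∩ A| |T \ A|`. The `2 ^ n - 1` stars with `T` non-empty of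
even cardinality are linearly independent (`linearIndependent_starVec`): for even `T`, the
alternating sum of `S_A` over `A ⊆ T` vanishes on the star of `T'` unless `T ⊆ T'`, and on the star
of `T` itself it is, up to sign, twice a central binomial coefficient. Hence the cone is
full-dimensional, and since every even star except that of `{i, j}` satisfies `S_i + S_j = S_{ij}`,
this equation cuts out a facet (`isFacet_saVec_singleton`). -/

namespace HolographicEntropy

/-! ### Representatives of sets of extended terminals -/

theorem mem_representative {n : ℕ} {A : Finset (ExtTerminal n)} {x : Fin n} :
    x ∈ representative A ↔ (some x ∈ A ↔ none ∉ A) := by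
  unfold representative
  split_ifs with h <;> simp [h]

theorem representative_empty {n : ℕ} : representative (∅ : Finset (ExtTerminal n)) = ∅ := by
  ext x; simp [mem_representative]

theorem eq_or_eq_compl_of_representative_eq {n : ℕ} {A B : Finset (ExtTerminal n)}
    (h : representative A = representative B) : A = B ∨ A = Bᶜ := by
  have hx (x : Fin n) : (some x ∈ A ↔ none ∉ A) ↔ (some x ∈ B ↔ none ∉ B) := by
    rw [← mem_representative, ← mem_representative, h]
  by_cases hA : none ∈ A <;> by_cases hB : none ∈ B
  · left; ext (_ | x)
    · simp [hA, hB]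
    · have := hx x; simp only [hA, hB] at this; tauto
  · right; ext (_ | x)
    · simp [hA, hB]
    · have := hx x; simp only [hA, hB] at this; simp only [Finset.mem_compl]; tauto
  · right; ext (_ | x)
    · simp [hA, hB]
    · have := hx x; simp only [hA, hB] at this; simp only [Finset.mem_compl]; tauto
  · left; ext (_ | x)
    · simp [hA, hB]
    · have := hx x; simp only [hA, hB] at this; tauto

theorem representative_nonempty {n : ℕ} {A : Finset (ExtTerminal n)}
    (h₀ : A.Nonempty) (h₁ : A ≠ Finset.univ) : (representative A).Nonempty := by
  rw [Finset.nonempty_iff_ne_empty]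
  intro h
  rw [← representative_empty] at h
  rcases eq_or_eq_compl_of_representative_eq h with h | h
  · exact h₀.ne_empty h
  · exact h₁ (by simpa using h)

theorem entry_apply_self {n : ℕ} {A : Finset (ExtTerminal n)} (h : (representative A).Nonempty) :
    entry A ⟨representative A, h⟩ = 1 := by
  simp [entry]

/-- The element `x` shows that `B` is not `A`, the element `y` that it is not the complement of
`A`. -/
theorem entry_apply_eq_zero {n : ℕ} {A B : Finset (ExtTerminal n)}
    (h : (representative A).Nonempty) (x y : ExtTerminal n)
    (hx : ¬ (x ∈ A ↔ x ∈ B)) (hy : y ∈ A ↔ y ∈ B) :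
    entry B ⟨representative A, h⟩ = 0 := by
  simp only [entry, ite_eq_right_iff, one_ne_zero, imp_false]
  intro hAB
  rcases eq_or_eq_compl_of_representative_eq hAB with rfl | rfl
  · exact hx Iff.rfl
  · simp at hy

theorem saVec_comm {n : ℕ} (I J : Finset (ExtTerminal n)) : saVec I J = saVec J I := by
  simp only [saVec, Finset.union_comm I J, add_comm (entry I)]

theorem saVec_apply_left {n : ℕ} {I J : Finset (ExtTerminal n)} (hI : I.Nonempty)
    (hJ : J.Nonempty) (hIJ : Disjoint I J) (hU : I ∪ J ≠ Finset.univ)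
    (h : (representative I).Nonempty) : saVec I J ⟨representative I, h⟩ = 1 := by
  obtain ⟨x, hx⟩ := hI
  obtain ⟨y, hy⟩ := hJ
  obtain ⟨z, hz⟩ : ∃ z, z ∉ I ∪ J := by simpa [Finset.eq_univ_iff_forall] using hU
  have hyI := Finset.disjoint_right.1 hIJ hy
  have hxJ := Finset.disjoint_left.1 hIJ hx
  simp only [Finset.mem_union, not_or] at hz
  simp only [saVec, Pi.add_apply, Pi.sub_apply, entry_apply_self]
  rw [entry_apply_eq_zero (B := J) h x z (by simp [hx, hxJ]) (by simp [hz]),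
    entry_apply_eq_zero (B := I ∪ J) h y x (by simp [hy, hyI]) (by simp [hx])]
  norm_num

theorem saVec_apply_union {n : ℕ} {I J : Finset (ExtTerminal n)} (hI : I.Nonempty)
    (hJ : J.Nonempty) (hIJ : Disjoint I J) (h : (representative (I ∪ J)).Nonempty) :
    saVec I J ⟨representative (I ∪ J), h⟩ = -1 := by
  obtain ⟨x, hx⟩ := hI
  obtain ⟨y, hy⟩ := hJ
  have hyI := Finset.disjoint_right.1 hIJ hy
  have hxJ := Finset.disjoint_left.1 hIJ hx
  simp only [saVec, Pi.add_apply, Pi.sub_apply, entry_apply_self]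
  rw [entry_apply_eq_zero (B := I) h y x (by simp [hy, hyI]) (by simp [hx]),
    entry_apply_eq_zero (B := J) h x y (by simp [hx, hxJ]) (by simp [hy])]
  norm_num

theorem ne_univ_of_disjoint_of_nonempty {α : Type*} [Fintype α] [DecidableEq α] {I J : Finset α}
    (hIJ : Disjoint I J) (hJ : J.Nonempty) : I ≠ Finset.univ := by
  rintro rfl
  obtain ⟨y, hy⟩ := hJ
  exact Finset.disjoint_right.1 hIJ hy (Finset.mem_univ y)

theorem representative_nonempty_of_disjoint {n : ℕ} {I J : Finset (ExtTerminal n)}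
    (hI : I.Nonempty) (hJ : J.Nonempty) (hIJ : Disjoint I J) : (representative I).Nonempty :=
  representative_nonempty hI (ne_univ_of_disjoint_of_nonempty hIJ hJ)

theorem saVec_ne_zero {n : ℕ} {I J : Finset (ExtTerminal n)} (hI : I.Nonempty)
    (hJ : J.Nonempty) (hIJ : Disjoint I J) (hU : I ∪ J ≠ Finset.univ) : saVec I J ≠ 0 := by
  intro h0
  have h := saVec_apply_left hI hJ hIJ hU (representative_nonempty_of_disjoint hI hJ hIJ)
  simp [h0] at h

/-! ### Zero-lifts of subadditivity -/

theorem substitute_entry {m n : ℕ} (F : Fin m → Finset (Fin n)) {A : Finset (ExtTerminal m)}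
    (h : (representative A).Nonempty) (I' : TerminalSet n) :
    substitute F (entry A) I' = if (representative A).biUnion F = I'.1 then 1 else 0 := by
  unfold substitute
  rw [Finset.sum_eq_single ⟨representative A, h⟩]
  · simp [entry]
  · intro I _ hI
    have : I.1 ≠ representative A := fun h' => hI (Subtype.ext h')
    simp [entry, this]
  · simp

theorem substitute_add {m n : ℕ} (F : Fin m → Finset (Fin n)) (q r : SVec m) :
    substitute F (q + r) = substitute F q + substitute F r := by
  ext I'
  simp only [substitute, Pi.add_apply, ← Finset.sum_add_distrib]
  refine Finset.sum_congr rfl fun I _ => ?_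
  split_ifs <;> simp

theorem substitute_sub {m n : ℕ} (F : Fin m → Finset (Fin n)) (q r : SVec m) :
    substitute F (q - r) = substitute F q - substitute F r := by
  ext I'
  simp only [substitute, Pi.sub_apply, ← Finset.sum_sub_distrib]
  refine Finset.sum_congr rfl fun I _ => ?_
  split_ifs <;> simp

open Classical in
/-- The map `[n; N] → [m; N]` collapsing each `F i` with `i ∈ s` to the terminal `i`, and everything
else to the sink. -/
noncomputable def collapse {m n : ℕ} (s : Set (Fin m)) (F : Fin m → Finset (Fin n)) :
    ExtTerminal n → ExtTerminal m
  | none => none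
  | some x => if h : ∃ i ∈ s, x ∈ F i then some h.choose else none

theorem collapse_eq_some_iff {m n : ℕ} {s : Set (Fin m)} {F : Fin m → Finset (Fin n)}
    (hF : s.PairwiseDisjoint F) {x : Fin n} {i : Fin m} :
    collapse s F (some x) = some i ↔ i ∈ s ∧ x ∈ F i := by
  simp only [collapse]
  split_ifs with h
  · have hs := h.choose_spec
    rw [Option.some_inj]
    constructor
    · intro h'; rwa [h'] at hs
    · intro h'
      by_contra hne
      exact Finset.disjoint_left.1 (hF hs.1 h'.1 hne) hs.2 h'.2
  · simp only [false_iff]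
    exact fun h' => h ⟨i, h'⟩

/-- Substituting `F` into `S_A` gives `S_B`, where `B` is the preimage of `A` under `collapse`. -/
theorem substitute_entry_eq_entry {m n : ℕ} {s : Set (Fin m)} {F : Fin m → Finset (Fin n)}
    (hF : s.PairwiseDisjoint F) {A : Finset (ExtTerminal m)}
    (h : (representative A).Nonempty) (hA : ∀ i ∈ representative A, i ∈ s) :
    substitute F (entry A) = entry (Finset.univ.filter fun y => collapse s F y ∈ A) := by
  have key : (representative A).biUnion F =
      representative (Finset.univ.filter fun y => collapse s F y ∈ A) := by
    ext x
    rw [mem_representative, Finset.mem_biUnion]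
    simp only [Finset.mem_filter, Finset.mem_univ, true_and]
    rw [show collapse s F none = none from rfl]
    constructor
    · rintro ⟨i, hi, hx⟩
      rw [(collapse_eq_some_iff hF).2 ⟨hA i hi, hx⟩]
      exact mem_representative.1 hi
    · intro hx
      rcases hc : collapse s F (some x) with _ | i
      · rw [hc] at hx; tauto
      · rw [hc] at hx
        exact ⟨i, mem_representative.2 hx, ((collapse_eq_some_iff hF).1 hc).2⟩
  ext I'
  rw [substitute_entry F h, key]
  simp only [entry, eq_comm]

theorem IsSubadditivity.of_isZeroLift {m n : ℕ} {q : SVec m} {q' : SVec n}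
    (hq : IsSubadditivity q) (hq' : IsZeroLift q q') : IsSubadditivity q' := by
  obtain ⟨I, J, hI, hJ, hIJ, hU, rfl⟩ := hq
  obtain ⟨F, hne, hF, rfl⟩ := hq'
  set s := appearing (saVec I J) with hs
  have hrI := representative_nonempty_of_disjoint hI hJ hIJ
  have hrJ := representative_nonempty_of_disjoint hJ hI hIJ.symm
  have hrU := representative_nonempty (hI.mono Finset.subset_union_left) hU
  have hIs : ∀ i ∈ representative I, i ∈ s := fun i hi =>
    ⟨⟨_, hrI⟩, hi, by rw [saVec_apply_left hI hJ hIJ hU]; norm_num⟩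
  have hJs : ∀ i ∈ representative J, i ∈ s := fun i hi =>
    ⟨⟨_, hrJ⟩, hi, by
      rw [saVec_comm, saVec_apply_left hJ hI hIJ.symm (by rwa [Finset.union_comm])]; norm_num⟩
  have hUs : ∀ i ∈ representative (I ∪ J), i ∈ s := fun i hi =>
    ⟨⟨_, hrU⟩, hi, by rw [saVec_apply_union hI hJ hIJ]; norm_num⟩
  have preimage_nonempty : ∀ A : Finset (ExtTerminal m), A.Nonempty →
      (∀ i ∈ representative A, i ∈ s) →
      (Finset.univ.filter fun y => collapse s F y ∈ A).Nonempty := by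
    intro A hA hAs
    by_cases h0 : none ∈ A
    · exact ⟨none, Finset.mem_filter.2 ⟨Finset.mem_univ _, h0⟩⟩
    · obtain ⟨_ | i, hi⟩ := hA
      · exact absurd hi h0
      · have his := hAs i (mem_representative.2 (by tauto))
        obtain ⟨x, hx⟩ := hne i his
        exact ⟨some x, by simpa [(collapse_eq_some_iff hF).2 ⟨his, hx⟩] using hi⟩
  have hunion : (Finset.univ.filter fun y => collapse s F y ∈ I) ∪
      (Finset.univ.filter fun y => collapse s F y ∈ J) =
      Finset.univ.filter fun y => collapse s F y ∈ I ∪ J := by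
    ext y; simp
  refine ⟨_, _, preimage_nonempty I hI hIs, preimage_nonempty J hJ hJs, ?_, ?_, ?_⟩
  · rw [Finset.disjoint_left]
    intro y hy hy'
    simp only [Finset.mem_filter, Finset.mem_univ, true_and] at hy hy'
    exact Finset.disjoint_left.1 hIJ hy hy'
  · rw [hunion]
    -- The complement of `I ∪ J` has the same representative, so its preimage is non-empty too.
    have hc : (I ∪ J)ᶜ.Nonempty := by
      rwa [Finset.nonempty_iff_ne_empty, Ne, Finset.compl_eq_empty_iff]
    obtain ⟨y, hy⟩ := preimage_nonempty (I ∪ J)ᶜ hc (fun i hi => hUs i (by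
      rw [mem_representative] at hi ⊢
      simp only [Finset.mem_compl] at hi
      tauto))
    intro h
    have hy' := h ▸ Finset.mem_univ y
    simp only [Finset.mem_filter, Finset.mem_univ, true_and, Finset.mem_compl] at hy hy'
    exact hy hy'
  · rw [saVec, substitute_sub, substitute_add, substitute_entry_eq_entry hF hrI hIs,
      substitute_entry_eq_entry hF hrJ hJs, substitute_entry_eq_entry hF hrU hUs, saVec, hunion]

/-! ### Cuts for sets of extended terminals -/

/-- Summing over ordered pairs counts every edge of the cut twice. -/
theorem two_mul_cutWeight {N : ℕ} (w : Sym2 (Fin N) → ℝ≥0) (W : Finset (Fin N)) :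
    2 * cutWeight w W = ∑ i, ∑ j, (w s(i, j) : ℝ) * if (i ∈ W ↔ j ∈ W) then 0 else 1 := by
  have h1 : cutWeight w W = ∑ i, ∑ j, if i ∈ W ∧ j ∉ W then (w s(i, j) : ℝ) else 0 := by
    unfold cutWeight
    rw [← Finset.sum_filter_add_sum_filter_not Finset.univ (· ∈ W)]
    rw [Finset.sum_eq_zero (s := Finset.univ.filter (· ∉ W)), add_zero]
    · rw [Finset.filter_univ_mem]
      refine Finset.sum_congr rfl fun i hi => ?_
      simp only [hi, true_and]
      rw [← Finset.sum_filter]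
      congr 1
      ext j; simp
    · intro i hi
      simp only [Finset.mem_filter, Finset.mem_univ, true_and] at hi
      simp [hi]
  have h2 : cutWeight w W = ∑ i, ∑ j, if j ∈ W ∧ i ∉ W then (w s(i, j) : ℝ) else 0 := by
    rw [h1, Finset.sum_comm]
    simp only [Sym2.eq_swap]
  rw [two_mul]
  nth_rewrite 1 [h1]
  rw [h2, ← Finset.sum_add_distrib]
  refine Finset.sum_congr rfl fun i _ => ?_
  rw [← Finset.sum_add_distrib]
  refine Finset.sum_congr rfl fun j _ => ?_
  by_cases hi : i ∈ W <;> by_cases hj : j ∈ W <;> simp [hi, hj]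

theorem cutWeight_compl {N : ℕ} (w : Sym2 (Fin N) → ℝ≥0) (W : Finset (Fin N)) :
    cutWeight w Wᶜ = cutWeight w W := by
  have h := two_mul_cutWeight w Wᶜ
  simp only [Finset.mem_compl, not_iff_not] at h
  rw [← two_mul_cutWeight] at h
  linarith

theorem cutWeight_nonneg {N : ℕ} (w : Sym2 (Fin N) → ℝ≥0) (W : Finset (Fin N)) :
    0 ≤ cutWeight w W :=
  Finset.sum_nonneg fun _ _ => Finset.sum_nonneg fun _ _ => NNReal.coe_nonneg _

theorem cutWeight_union_le {N : ℕ} (w : Sym2 (Fin N) → ℝ≥0) (U V : Finset (Fin N)) :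
    cutWeight w (U ∪ V) ≤ cutWeight w U + cutWeight w V := by
  suffices h : 2 * cutWeight w (U ∪ V) ≤ 2 * cutWeight w U + 2 * cutWeight w V by linarith
  simp only [two_mul_cutWeight, ← Finset.sum_add_distrib, ← mul_add]
  refine Finset.sum_le_sum fun i _ => Finset.sum_le_sum fun j _ =>
    mul_le_mul_of_nonneg_left ?_ (NNReal.coe_nonneg _)
  by_cases h1 : i ∈ U <;> by_cases h2 : i ∈ V <;> by_cases h3 : j ∈ U <;> by_cases h4 : j ∈ V <;>
    simp [h1, h2, h3, h4]

/-- The cut inequality behind monogamy: the map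
`(x, y, z) ↦ (x ∧ y ∧ ¬z, x ∧ z ∧ ¬y, y ∧ z ∧ ¬x, x ∨ y ∨ z)` from `{0,1}³` to `{0,1}⁴` does not
increase Hamming distances. -/
theorem cutWeight_contraction {N : ℕ} (w : Sym2 (Fin N) → ℝ≥0) (X Y Z : Finset (Fin N)) :
    cutWeight w ((X ∩ Y) \ Z) + cutWeight w ((X ∩ Z) \ Y) + cutWeight w ((Y ∩ Z) \ X)
      + cutWeight w (X ∪ Y ∪ Z) ≤ cutWeight w X + cutWeight w Y + cutWeight w Z := by
  suffices h : 2 * cutWeight w ((X ∩ Y) \ Z) + 2 * cutWeight w ((X ∩ Z) \ Y)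
      + 2 * cutWeight w ((Y ∩ Z) \ X) + 2 * cutWeight w (X ∪ Y ∪ Z)
      ≤ 2 * cutWeight w X + 2 * cutWeight w Y + 2 * cutWeight w Z by linarith
  simp only [two_mul_cutWeight, ← Finset.sum_add_distrib, ← mul_add]
  refine Finset.sum_le_sum fun i _ => Finset.sum_le_sum fun j _ =>
    mul_le_mul_of_nonneg_left ?_ (NNReal.coe_nonneg _)
  by_cases h1 : i ∈ X <;> by_cases h2 : i ∈ Y <;> by_cases h3 : i ∈ Z <;>
  by_cases h4 : j ∈ X <;> by_cases h5 : j ∈ Y <;> by_cases h6 : j ∈ Z <;>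
    simp [h1, h2, h3, h4, h5, h6]

/-- The vertex of the complete graph on `Fin (k + 1)` that is the given terminal or the sink. -/
def extVertex {n k : ℕ} (h : n ≤ k) : ExtTerminal n → Fin (k + 1)
  | none => Fin.last k
  | some i => (Fin.castLE h i).castSucc

theorem extVertex_injective {n k : ℕ} (h : n ≤ k) : Function.Injective (extVertex h) := by
  rintro (_ | i) (_ | j) hij
  · rfl
  · exact absurd hij.symm (Fin.castSucc_ne_last _)
  · exact absurd hij (Fin.castSucc_ne_last _)
  · simpa [extVertex] using hij

/-- The vertex sets whose extended terminals are precisely those in `A`; unlike in `IsCutFor`, the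
sink is allowed. -/
def extCuts {n k : ℕ} (h : n ≤ k) (A : Finset (ExtTerminal n)) : Set (Finset (Fin (k + 1))) :=
  {W | ∀ t, extVertex h t ∈ W ↔ t ∈ A}

theorem isCutFor_iff {n k : ℕ} (h : n ≤ k) (W : Finset (Fin (k + 1))) (I : Finset (Fin n)) :
    IsCutFor h W I ↔ W ∈ extCuts h (I.map Function.Embedding.some) := by
  constructor
  · rintro ⟨h0, h1⟩ (_ | i)
    · simpa [extVertex] using h0
    · simpa [extVertex] using h1 i
  · intro hW
    refine ⟨by simpa [extVertex] using hW none, fun i => by simpa [extVertex] using hW (some i)⟩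

theorem image_extCuts {n k : ℕ} (h : n ≤ k) (w : Sym2 (Fin (k + 1)) → ℝ≥0)
    (A : Finset (ExtTerminal n)) :
    cutWeight w '' extCuts h A = cutWeight w '' {W | IsCutFor h W (representative A)} := by
  by_cases h0 : none ∈ A
  · have hc : ∀ W, W ∈ extCuts h A ↔ IsCutFor h Wᶜ (representative A) := by
      intro W
      rw [isCutFor_iff]
      refine forall_congr' fun t => ?_
      rcases t with _ | i
      · simp [h0]
      · simp only [Finset.mem_compl, Function.Embedding.some_apply,
          Finset.mem_map, Option.some_inj, exists_eq_right, mem_representative, h0]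
        tauto
    apply Set.Subset.antisymm
    · rintro _ ⟨W, hW, rfl⟩
      exact ⟨Wᶜ, (hc W).1 hW, cutWeight_compl w W⟩
    · rintro _ ⟨W, hW, rfl⟩
      exact ⟨Wᶜ, (hc _).2 (by rwa [compl_compl]), cutWeight_compl w W⟩
  · congr 1
    ext W
    rw [Set.mem_ofPred_eq, isCutFor_iff]
    refine forall_congr' fun t => ?_
    rcases t with _ | i
    · simp [h0]
    · simp [mem_representative, h0]

theorem entry_dotProduct {n : ℕ} {A : Finset (ExtTerminal n)} (h : (representative A).Nonempty)
    (S : SVec n) : entry A ⬝ᵥ S = S ⟨representative A, h⟩ := by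
  rw [dotProduct, Finset.sum_eq_single ⟨representative A, h⟩]
  · simp [entry]
  · intro I _ hI
    have : I.1 ≠ representative A := fun h' => hI (Subtype.ext h')
    simp [entry, this]
  · simp

/-- For every set `A` of extended terminals, `S_A` is the minimum weight of a cut separating `A`
from the other extended terminals. For `A = ∅` and `A = [n; N]` both are `0`. -/
theorem Realizes.isLeast_entry {n k : ℕ} {h : n ≤ k} {w : Sym2 (Fin (k + 1)) → ℝ≥0} {S : SVec n}
    (hS : Realizes h w S) (A : Finset (ExtTerminal n)) :
    IsLeast (cutWeight w '' extCuts h A) (entry A ⬝ᵥ S) := by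
  rw [image_extCuts]
  by_cases hA : (representative A).Nonempty
  · rw [entry_dotProduct hA]
    exact hS ⟨_, hA⟩
  · have h0 : entry A ⬝ᵥ S = 0 := Finset.sum_eq_zero fun I _ => by
      have : I.1 ≠ representative A := fun h' => hA (h' ▸ I.2)
      simp [entry, this]
    rw [h0, Finset.not_nonempty_iff_eq_empty.1 hA]
    refine ⟨⟨∅, by simp [IsCutFor], by simp [cutWeight]⟩, ?_⟩
    rintro _ ⟨W, -, rfl⟩
    exact cutWeight_nonneg w W

/-! ### Validity of subadditivity and monogamy -/

theorem isValid_saVec {n : ℕ} (I J : Finset (ExtTerminal n)) : IsValid (saVec I J) := by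
  rintro S ⟨k, h, w, hS⟩
  obtain ⟨⟨U, hU, hUI⟩, -⟩ := hS.isLeast_entry I
  obtain ⟨⟨V, hV, hVJ⟩, -⟩ := hS.isLeast_entry J
  have hle := (hS.isLeast_entry (I ∪ J)).2 ⟨U ∪ V, fun t => by simp [hU t, hV t], rfl⟩
  have := cutWeight_union_le w U V
  simp only [saVec, sub_dotProduct, add_dotProduct]
  linarith

theorem isValid_mmiVec {n : ℕ} {I J K : Finset (ExtTerminal n)} (hIJ : Disjoint I J)
    (hIK : Disjoint I K) (hJK : Disjoint J K) : IsValid (mmiVec I J K) := by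
  rintro S ⟨k, h, w, hS⟩
  obtain ⟨⟨X, hX, hX'⟩, -⟩ := hS.isLeast_entry (I ∪ J)
  obtain ⟨⟨Y, hY, hY'⟩, -⟩ := hS.isLeast_entry (I ∪ K)
  obtain ⟨⟨Z, hZ, hZ'⟩, -⟩ := hS.isLeast_entry (J ∪ K)
  rw [Finset.disjoint_left] at hIJ hIK hJK
  have h1 := (hS.isLeast_entry I).2 ⟨(X ∩ Y) \ Z, fun t => by
    have := @hIJ t; have := @hIK t; have := @hJK t
    simp only [Finset.mem_sdiff, Finset.mem_inter, hX t, hY t, hZ t, Finset.mem_union]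
    tauto, rfl⟩
  have h2 := (hS.isLeast_entry J).2 ⟨(X ∩ Z) \ Y, fun t => by
    have := @hIJ t; have := @hIK t; have := @hJK t
    simp only [Finset.mem_sdiff, Finset.mem_inter, hX t, hY t, hZ t, Finset.mem_union]
    tauto, rfl⟩
  have h3 := (hS.isLeast_entry K).2 ⟨(Y ∩ Z) \ X, fun t => by
    have := @hIJ t; have := @hIK t; have := @hJK t
    simp only [Finset.mem_sdiff, Finset.mem_inter, hX t, hY t, hZ t, Finset.mem_union]
    tauto, rfl⟩
  have h4 := (hS.isLeast_entry (I ∪ J ∪ K)).2 ⟨X ∪ Y ∪ Z, fun t => by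
    simp only [Finset.mem_union, hX t, hY t, hZ t]
    tauto, rfl⟩
  have := cutWeight_contraction w X Y Z
  simp only [mmiVec, sub_dotProduct, add_dotProduct]
  linarith

theorem saVec_union {n : ℕ} (I J K : Finset (ExtTerminal n)) :
    saVec I (J ∪ K) = saVec I J + mmiVec I J K + saVec I K := by
  simp only [saVec, mmiVec, Finset.union_assoc]
  abel

/-! ### Star graphs -/

theorem cutWeight_sum {N : ℕ} {ι : Type*} (s : Finset ι) (w : ι → Sym2 (Fin N) → ℝ≥0)
    (W : Finset (Fin N)) :
    cutWeight (fun e => ∑ t ∈ s, w t e) W = ∑ t ∈ s, cutWeight (w t) W := by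
  simp only [cutWeight, NNReal.coe_sum]
  rw [Finset.sum_comm (s := s)]
  exact Finset.sum_congr rfl fun i _ => Finset.sum_comm

theorem cutWeight_edge {N : ℕ} (a b : Fin N) (W : Finset (Fin N)) :
    cutWeight (fun e => if e = s(a, b) then 1 else 0) W = if (a ∈ W ↔ b ∈ W) then 0 else 1 := by
  have key : ∀ a b : Fin N, a ∈ W → b ∉ W →
      cutWeight (fun e => if e = s(a, b) then 1 else 0) W = 1 := by
    intro a b ha hb
    unfold cutWeight
    rw [Finset.sum_eq_single_of_mem a ha, Finset.sum_eq_single_of_mem b (by simpa using hb)]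
    · simp
    · intro j _ hj
      have : a ≠ b := fun h => hb (h ▸ ha)
      simp [hj, this]
    · intro i hi hia
      refine Finset.sum_eq_zero fun j hj => ?_
      have : i ≠ b := fun h => hb (h ▸ hi)
      simp [hia, this]
  by_cases ha : a ∈ W <;> by_cases hb : b ∈ W
  · rw [if_pos (by tauto)]
    refine Finset.sum_eq_zero fun i hi => Finset.sum_eq_zero fun j hj => ?_
    rw [Finset.mem_compl] at hj
    have h1 : j ≠ a := fun h => hj (h ▸ ha)
    have h2 : j ≠ b := fun h => hj (h ▸ hb)
    simp [h1, h2]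
  · rw [if_neg (by tauto)]; exact key a b ha hb
  · rw [if_neg (by tauto), Sym2.eq_swap]; exact key b a hb ha
  · rw [if_pos (by tauto)]
    refine Finset.sum_eq_zero fun i hi => Finset.sum_eq_zero fun j hj => ?_
    have h1 : i ≠ a := fun h => ha (h ▸ hi)
    have h2 : i ≠ b := fun h => hb (h ▸ hi)
    simp [h1, h2]

/-- The star graph with unit edges from one bulk vertex, the hub `n`, to the extended terminals in
`T`, as a weighting of the complete graph on `n + 2` vertices. -/
def starWeight {n : ℕ} (T : Finset (ExtTerminal n)) : Sym2 (Fin (n + 1 + 1)) → ℝ≥0 :=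
  fun e => ∑ t ∈ T, if e = s((Fin.last n).castSucc, extVertex n.le_succ t) then 1 else 0

/-- The value of `S_A` on the star graph of `T`: the hub lies on the cheaper side. -/
def starValue {n : ℕ} (T A : Finset (ExtTerminal n)) : ℝ :=
  min ((T ∩ A).card : ℝ) ((T \ A).card : ℝ)

/-- The `S`-vector of the star graph of `T`. -/
def starVec {n : ℕ} (T : Finset (ExtTerminal n)) : SVec n :=
  fun I => starValue T (I.1.map Function.Embedding.some)

theorem extVertex_ne_hub {n : ℕ} (t : ExtTerminal n) :
    extVertex n.le_succ t ≠ (Fin.last n).castSucc := by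
  rcases t with _ | i
  · exact (Fin.castSucc_ne_last _).symm
  · intro h
    have := congrArg Fin.val h
    simp only [extVertex, Fin.val_castSucc, Fin.val_castLE, Fin.val_last] at this
    exact i.2.ne this

theorem cutWeight_starWeight {n : ℕ} (T A : Finset (ExtTerminal n)) {W : Finset (Fin (n + 1 + 1))}
    (hW : W ∈ extCuts n.le_succ A) :
    cutWeight (starWeight T) W =
      if (Fin.last n).castSucc ∈ W then ((T \ A).card : ℝ) else ((T ∩ A).card : ℝ) := by
  unfold starWeight
  rw [cutWeight_sum]
  simp only [cutWeight_edge, hW _]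
  split_ifs with h
  · simp only [h, true_iff]
    rw [Finset.sum_ite, Finset.sum_const_zero, zero_add, Finset.sum_const, nsmul_one,
      Finset.sdiff_eq_filter]
  · simp only [h, false_iff, ite_not]
    rw [Finset.sum_ite, Finset.sum_const_zero, add_zero, Finset.sum_const, nsmul_one,
      Finset.filter_mem_eq_inter]

theorem isLeast_starValue {n : ℕ} (T A : Finset (ExtTerminal n)) :
    IsLeast (cutWeight (starWeight T) '' extCuts n.le_succ A) (starValue T A) := by
  have hub : ∀ t : ExtTerminal n, extVertex n.le_succ t ≠ (Fin.last n).castSucc := extVertex_ne_hub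
  have hA : A.image (extVertex n.le_succ) ∈ extCuts n.le_succ A := fun t =>
    (extVertex_injective n.le_succ).mem_finset_image
  have hA' : insert (Fin.last n).castSucc (A.image (extVertex n.le_succ)) ∈
      extCuts n.le_succ A := fun t => by
    rw [Finset.mem_insert, or_iff_right (hub t)]; exact hA t
  constructor
  · rcases min_choice ((T ∩ A).card : ℝ) ((T \ A).card : ℝ) with h | h
    · refine ⟨_, hA, ?_⟩
      rw [cutWeight_starWeight T A hA, if_neg (by simpa using fun t _ => hub t), starValue, h]
    · refine ⟨_, hA', ?_⟩
      rw [cutWeight_starWeight T A hA', if_pos (Finset.mem_insert_self _ _), starValue, h]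
  · rintro _ ⟨W, hW, rfl⟩
    rw [cutWeight_starWeight T A hW]
    split_ifs
    · exact min_le_right _ _
    · exact min_le_left _ _

theorem realizes_starVec {n : ℕ} (T : Finset (ExtTerminal n)) :
    Realizes n.le_succ (starWeight T) (starVec T) := by
  intro I
  simp only [isCutFor_iff]
  exact isLeast_starValue T _

theorem starVec_mem_holographicCone {n : ℕ} (T : Finset (ExtTerminal n)) :
    starVec T ∈ holographicCone n :=
  ⟨n + 1, n.le_succ, starWeight T, realizes_starVec T⟩

theorem entry_dotProduct_starVec {n : ℕ} (A T : Finset (ExtTerminal n)) :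
    entry A ⬝ᵥ starVec T = starValue T A :=
  ((realizes_starVec T).isLeast_entry A).unique (isLeast_starValue T A)

/-! ### Even stars form a basis -/

/-- The alternating sum of the values of a star over the subsets of a set not contained in it
vanishes: toggling a missing element does not change the value but changes the sign. -/
theorem sum_powerset_starValue_eq_zero {n : ℕ} {T T' : Finset (ExtTerminal n)} (h : ¬ T ⊆ T') :
    ∑ A ∈ T.powerset, (-1 : ℝ) ^ A.card * starValue T' A = 0 := by
  obtain ⟨t, ht, ht'⟩ := Finset.not_subset.1 h
  rw [← Finset.insert_erase ht, Finset.sum_powerset_insert (Finset.notMem_erase t T),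
    ← Finset.sum_add_distrib]
  refine Finset.sum_eq_zero fun A hA => ?_
  have htA : t ∉ A := fun h => Finset.notMem_erase t T (Finset.mem_powerset.1 hA h)
  have hv : starValue T' (insert t A) = starValue T' A := by
    rw [starValue, Finset.inter_insert_of_notMem ht', Finset.sdiff_insert_of_notMem ht', starValue]
  rw [Finset.card_insert_of_notMem htA, hv]
  ring

/-- The second difference of `x ↦ min x (2 s + 2 - x)` is concentrated at `x = s`. -/
theorem min_second_difference (s x : ℕ) (hx : x ≤ 2 * s) :
    min (x : ℝ) (2 * s + 2 - x) - 2 * min ((x : ℝ) + 1) (2 * s + 1 - x)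
      + min ((x : ℝ) + 2) (2 * s - x) = if x = s then -2 else 0 := by
  rcases lt_trichotomy x s with h | rfl | h
  · have h' : (x : ℝ) + 1 ≤ s := by exact_mod_cast h
    rw [if_neg h.ne, min_eq_left (by linarith), min_eq_left (by linarith),
      min_eq_left (by linarith)]
    ring
  · rw [if_pos rfl, min_eq_left (by linarith), min_eq_left (by linarith),
      min_eq_right (by linarith)]
    ring
  · have h' : (s : ℝ) + 1 ≤ x := by exact_mod_cast h
    rw [if_neg h.ne', min_eq_right (by linarith), min_eq_right (by linarith),
      min_eq_right (by linarith)]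
    ring

theorem sum_powerset_starValue_self_ne_zero {n : ℕ} {T : Finset (ExtTerminal n)}
    (hT : T.Nonempty) (he : Even T.card) :
    ∑ A ∈ T.powerset, (-1 : ℝ) ^ A.card * starValue T A ≠ 0 := by
  obtain ⟨s, hs⟩ : ∃ s, T.card = 2 * s + 2 := by
    obtain ⟨r, hr⟩ := he
    have := hT.card_pos
    exact ⟨r - 1, by omega⟩
  have hval : ∀ A ∈ T.powerset, starValue T A = min (A.card : ℝ) (2 * s + 2 - A.card) := by
    intro A hA
    rw [Finset.mem_powerset] at hA
    rw [starValue, Finset.inter_eq_right.2 hA, Finset.card_sdiff_of_subset hA,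
      Nat.cast_sub (Finset.card_le_card hA), hs]
    push_cast
    rfl
  rw [Finset.sum_congr rfl fun A hA => by rw [hval A hA]]
  -- Split off two elements of `T` and sum over the rest.
  obtain ⟨a, ha⟩ := hT
  have hca : (T.erase a).card = 2 * s + 1 := by rw [Finset.card_erase_of_mem ha, hs]; rfl
  obtain ⟨b, hb⟩ : (T.erase a).Nonempty := Finset.card_pos.1 (by omega)
  set R := (T.erase a).erase b with hR
  have hcR : R.card = 2 * s := by rw [hR, Finset.card_erase_of_mem hb, hca]; rfl
  have hbR : b ∉ R := Finset.notMem_erase _ _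
  have haR : a ∉ insert b R := by
    rw [hR, Finset.insert_erase hb]; exact Finset.notMem_erase _ _
  have hTR : T = insert a (insert b R) := by
    rw [hR, Finset.insert_erase hb, Finset.insert_erase ha]
  rw [hTR, Finset.sum_powerset_insert haR, Finset.sum_powerset_insert hbR,
    Finset.sum_powerset_insert hbR, ← Finset.sum_add_distrib, ← Finset.sum_add_distrib,
    ← Finset.sum_add_distrib]
  have hterm : ∀ A ∈ R.powerset,
      ((-1 : ℝ) ^ A.card * min (A.card : ℝ) (2 * s + 2 - A.card)
        + (-1 : ℝ) ^ (insert b A).card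
          * min ((insert b A).card : ℝ) (2 * s + 2 - (insert b A).card)
        + ((-1 : ℝ) ^ (insert a A).card
          * min ((insert a A).card : ℝ) (2 * s + 2 - (insert a A).card)
        + (-1 : ℝ) ^ (insert a (insert b A)).card
          * min ((insert a (insert b A)).card : ℝ) (2 * s + 2 - (insert a (insert b A)).card)))
      = if A.card = s then (-1) ^ s * (-2) else 0 := by
    intro A hA
    rw [Finset.mem_powerset] at hA
    have hbA : b ∉ A := fun h => hbR (hA h)
    have haA' : a ∉ insert b A := fun h => haR (Finset.insert_subset_insert b hA h)
    have haA : a ∉ A := fun h => haA' (Finset.mem_insert_of_mem h)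
    have hd := min_second_difference s A.card (by
      rw [← hcR]; exact Finset.card_le_card hA)
    rw [Finset.card_insert_of_notMem haA', Finset.card_insert_of_notMem hbA,
      Finset.card_insert_of_notMem haA]
    push_cast
    rw [show (2 * s + 2 - ((A.card : ℝ) + 1)) = 2 * s + 1 - A.card by ring,
      show (2 * s + 2 - ((A.card : ℝ) + 1 + 1)) = 2 * s - A.card by ring,
      show ((A.card : ℝ) + 1 + 1) = A.card + 2 by ring]
    transitivity (-1) ^ A.card * (if A.card = s then (-2 : ℝ) else 0)
    · rw [← hd]; ring
    · split_ifs with h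
      · rw [h]
      · simp
  rw [Finset.sum_congr rfl hterm, ← Finset.sum_filter, Finset.sum_const,
    ← Finset.powersetCard_eq_filter, Finset.card_powersetCard, hcR, nsmul_eq_mul]
  have : (2 * s).choose s ≠ 0 := (Nat.choose_pos (by omega)).ne'
  have : ((2 * s).choose s : ℝ) ≠ 0 := by exact_mod_cast this
  positivity

/-- The set of even cardinality obtained from `I` by adding the sink if necessary. Every non-empty
set of extended terminals of even cardinality arises from exactly one non-empty `I`. -/
def evenExt {n : ℕ} (I : Finset (Fin n)) : Finset (ExtTerminal n) :=
  if Even I.card then I.map Function.Embedding.some else Finset.insertNone I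

theorem even_card_evenExt {n : ℕ} (I : Finset (Fin n)) : Even (evenExt I).card := by
  unfold evenExt
  split_ifs with h
  · simpa using h
  · rw [Finset.card_insertNone, Nat.even_add_one]; exact h

theorem some_mem_evenExt {n : ℕ} {I : Finset (Fin n)} {i : Fin n} :
    some i ∈ evenExt I ↔ i ∈ I := by
  unfold evenExt
  split_ifs <;> simp

theorem subset_of_evenExt_subset {n : ℕ} {I J : Finset (Fin n)} (h : evenExt I ⊆ evenExt J) :
    I ⊆ J := fun _ hi => some_mem_evenExt.1 (h (some_mem_evenExt.2 hi))

/-- The even stars are linearly independent: pairing them with the alternating sums of `S_A` over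
the subsets of an even set gives a triangular matrix. -/
theorem linearIndependent_starVec (n : ℕ) :
    LinearIndependent ℝ fun I : TerminalSet n => starVec (evenExt I.1) := by
  rw [Fintype.linearIndependent_iff]
  intro g hg
  by_contra! hne
  obtain ⟨I, hI, hmax⟩ := Finset.exists_maximal (s := Finset.univ.filter fun I => g I ≠ 0)
    (by obtain ⟨I, hI⟩ := hne; exact ⟨I, by simpa using hI⟩)
  simp only [Finset.mem_filter, Finset.mem_univ, true_and] at hI hmax
  set φ : SVec n := ∑ A ∈ (evenExt I.1).powerset, (-1 : ℝ) ^ A.card • entry A with hφ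
  have hφv : ∀ T, φ ⬝ᵥ starVec T =
      ∑ A ∈ (evenExt I.1).powerset, (-1 : ℝ) ^ A.card * starValue T A := by
    intro T
    simp only [hφ, sum_dotProduct, smul_dotProduct, entry_dotProduct_starVec, smul_eq_mul]
  have h0 : φ ⬝ᵥ (∑ J, g J • starVec (evenExt J.1)) = 0 := by rw [hg]; simp
  simp only [dotProduct_sum, dotProduct_smul, smul_eq_mul] at h0
  rw [Finset.sum_eq_single I] at h0
  · rw [hφv] at h0
    obtain ⟨i, hi⟩ := I.2
    exact mul_ne_zero hI (sum_powerset_starValue_self_ne_zero ⟨some i, some_mem_evenExt.2 hi⟩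
      (even_card_evenExt I.1)) h0
  · intro J _ hJ
    by_cases hgJ : g J = 0
    · simp [hgJ]
    · rw [hφv, sum_powerset_starValue_eq_zero, mul_zero]
      intro hsub
      have hle : I ≤ J := subset_of_evenExt_subset hsub
      exact hJ (le_antisymm (hmax hgJ hle) hle)
  · simp

theorem finrank_span_holographicCone (n : ℕ) :
    Module.finrank ℝ (Submodule.span ℝ (holographicCone n)) =
      Fintype.card (TerminalSet n) := by
  apply le_antisymm
  · simpa using Submodule.finrank_le (Submodule.span ℝ (holographicCone n))
  · rw [← finrank_span_eq_card (linearIndependent_starVec n)]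
    apply Submodule.finrank_mono
    apply Submodule.span_mono
    rintro _ ⟨I, rfl⟩
    exact starVec_mem_holographicCone _

/-! ### Faces -/

/-- The linear form `S ↦ q S`. -/
def dotForm {n : ℕ} (q : SVec n) : Module.Dual ℝ (SVec n) := dotProductBilin ℝ ℝ q

theorem dotForm_apply {n : ℕ} (q S : SVec n) : dotForm q S = q ⬝ᵥ S := rfl

theorem finrank_ker_dotForm_add_one {n : ℕ} {q : SVec n} (hq : q ≠ 0) :
    Module.finrank ℝ (LinearMap.ker (dotForm q)) + 1 = Fintype.card (TerminalSet n) := by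
  have h : dotForm q ≠ 0 := by
    intro h
    apply hq
    apply dotProduct_self_eq_zero.1
    rw [← dotForm_apply, h]; rfl
  rw [Module.Dual.finrank_ker_add_one_of_ne_zero h]
  simp

theorem span_face_le_ker {n : ℕ} (q : SVec n) :
    Submodule.span ℝ {S | S ∈ holographicCone n ∧ q ⬝ᵥ S = 0} ≤ LinearMap.ker (dotForm q) := by
  rw [Submodule.span_le]
  exact fun S hS => hS.2

theorem saVec_dotProduct_starVec_eq_zero {n : ℕ} {i j : ExtTerminal n} (hij : i ≠ j)
    {T : Finset (ExtTerminal n)} (he : Even T.card) (hT : T ≠ {i, j}) :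
    saVec {i} {j} ⬝ᵥ starVec T = 0 := by
  simp only [saVec, sub_dotProduct, add_dotProduct, entry_dotProduct_starVec, starValue]
  have hc : ∀ A : Finset (ExtTerminal n), ((T \ A).card : ℝ) = T.card - (T ∩ A).card := by
    intro A
    rw [eq_sub_iff_add_eq]
    exact_mod_cast Finset.card_sdiff_add_card_inter T A
  rw [hc, hc, hc]
  have hu : ({i} ∪ {j} : Finset (ExtTerminal n)) = {i, j} := rfl
  rw [hu]
  by_cases hi : i ∈ T <;> by_cases hj : j ∈ T
  · have hsub : {i, j} ⊆ T := by simp [Finset.insert_subset_iff, hi, hj]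
    have h2 : ({i, j} : Finset (ExtTerminal n)).card = 2 := Finset.card_pair hij
    have hlt := Finset.card_lt_card (lt_of_le_of_ne hsub hT.symm)
    have h4 : 4 ≤ T.card := by obtain ⟨r, hr⟩ := he; omega
    have h4' : (4 : ℝ) ≤ T.card := by exact_mod_cast h4
    rw [Finset.inter_eq_right.2 hsub, h2, Finset.inter_singleton_of_mem hi,
      Finset.inter_singleton_of_mem hj]
    simp only [Finset.card_singleton]
    push_cast
    rw [min_eq_left (by linarith), min_eq_left (by linarith)]
    norm_num
  · have : T ∩ {i, j} = {i} := by
      ext x; simp only [Finset.mem_inter, Finset.mem_insert, Finset.mem_singleton]; grind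
    rw [this, Finset.inter_singleton_of_mem hi, Finset.inter_singleton_of_notMem hj]
    simp
  · have : T ∩ {i, j} = {j} := by
      ext x; simp only [Finset.mem_inter, Finset.mem_insert, Finset.mem_singleton]; grind
    rw [this, Finset.inter_singleton_of_mem hj, Finset.inter_singleton_of_notMem hi]
    simp
  · have : T ∩ {i, j} = ∅ := by
      ext x; simp only [Finset.mem_inter, Finset.mem_insert, Finset.mem_singleton]; grind
    rw [this, Finset.inter_singleton_of_notMem hj, Finset.inter_singleton_of_notMem hi]
    simp

theorem isFacet_saVec_singleton {n : ℕ} (hn : 2 ≤ n) {i j : ExtTerminal n} (hij : i ≠ j) :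
    IsFacet (saVec {i} {j}) := by
  refine ⟨isValid_saVec _ _, ?_⟩
  have hU : ({i} ∪ {j} : Finset (ExtTerminal n)) ≠ Finset.univ := by
    intro h
    have h2 : ({i, j} : Finset (ExtTerminal n)).card = 2 := Finset.card_pair hij
    have h3 := congrArg Finset.card h
    rw [Finset.card_univ, Fintype.card_option, Fintype.card_fin] at h3
    have : ({i} ∪ {j} : Finset (ExtTerminal n)).card = 2 := h2
    omega
  have hker := finrank_ker_dotForm_add_one (saVec_ne_zero (Finset.singleton_nonempty i)
    (Finset.singleton_nonempty j) (by simpa using hij) hU)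
  rw [finrank_span_holographicCone, ← hker, add_left_inj]
  apply le_antisymm (Submodule.finrank_mono (span_face_le_ker _))
  -- All even stars other than the one on `{i, j}` lie on the face.
  set I₀ : Finset (Fin n) := Finset.eraseNone {i, j} with hI₀
  have hI₀u : ∀ I : Finset (Fin n), evenExt I = {i, j} → I = I₀ := by
    intro I hI
    ext x
    rw [hI₀, ← hI, Finset.mem_eraseNone, some_mem_evenExt]
  have hcard : Fintype.card (TerminalSet n) ≤
      Fintype.card {I : TerminalSet n // I.1 ≠ I₀} + 1 := by
    rw [Fintype.card_subtype_compl (fun I : TerminalSet n => I.1 = I₀)]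
    have : Fintype.card {I : TerminalSet n // I.1 = I₀} ≤ 1 := by
      rw [Fintype.card_le_one_iff]
      rintro ⟨a, ha⟩ ⟨b, hb⟩
      exact Subtype.ext (Subtype.ext (ha.trans hb.symm))
    omega
  have hli : LinearIndependent ℝ
      fun I : {I : TerminalSet n // I.1 ≠ I₀} => starVec (evenExt I.1.1) :=
    (linearIndependent_starVec n).comp _ Subtype.val_injective
  have hle : Fintype.card {I : TerminalSet n // I.1 ≠ I₀} ≤ Module.finrank ℝ
      (Submodule.span ℝ {S | S ∈ holographicCone n ∧ saVec {i} {j} ⬝ᵥ S = 0}) := by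
    rw [← finrank_span_eq_card hli]
    apply Submodule.finrank_mono
    apply Submodule.span_mono
    rintro _ ⟨I, rfl⟩
    exact ⟨starVec_mem_holographicCone _, saVec_dotProduct_starVec_eq_zero hij
      (even_card_evenExt _) fun h => I.2 (hI₀u _ h)⟩
  omega

/-- The face of a sum of valid inequalities is contained in the faces of the summands. If the
hyperplane of the sum is not contained in that of some summand, the face therefore does not span its
hyperplane. -/
theorem not_isFacet_of_eq_add {n : ℕ} {q a b c : SVec n} (hq : q ≠ 0) (h : q = a + b + c)
    (ha : IsValid a) (hb : IsValid b) (hc : IsValid c) {S : SVec n} (hqS : q ⬝ᵥ S = 0)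
    (haS : a ⬝ᵥ S ≠ 0) : ¬ IsFacet q := by
  rintro ⟨-, hf⟩
  rw [finrank_span_holographicCone, ← finrank_ker_dotForm_add_one hq, add_left_inj] at hf
  have heq := Submodule.eq_of_le_of_finrank_eq (span_face_le_ker q) hf
  have hle : Submodule.span ℝ {S | S ∈ holographicCone n ∧ q ⬝ᵥ S = 0} ≤
      LinearMap.ker (dotForm a) := by
    rw [Submodule.span_le]
    rintro S ⟨hS, hS0⟩
    have h1 := ha S hS
    have h2 := hb S hS
    have h3 := hc S hS
    rw [h, add_dotProduct, add_dotProduct] at hS0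
    have h0 : a ⬝ᵥ S = 0 := by linarith
    exact h0
  rw [heq] at hle
  exact haS (hle (x := S) hqS)

theorem not_isFacet_saVec_union {n : ℕ} {I J K : Finset (ExtTerminal n)} (hI : I.Nonempty)
    (hJ : J.Nonempty) (hK : K.Nonempty) (hIJ : Disjoint I J) (hIK : Disjoint I K)
    (hJK : Disjoint J K) (hU : I ∪ (J ∪ K) ≠ Finset.univ) : ¬ IsFacet (saVec I (J ∪ K)) := by
  have hr := representative_nonempty_of_disjoint hJ hI hIJ.symm
  have hIJK : Disjoint I (J ∪ K) := Finset.disjoint_union_right.2 ⟨hIJ, hIK⟩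
  have hU' : J ∪ I ≠ Finset.univ :=
    ne_univ_of_disjoint_of_nonempty (Finset.disjoint_union_left.2 ⟨hJK, hIK⟩) hK
  refine not_isFacet_of_eq_add (S := Pi.single ⟨representative J, hr⟩ 1)
    (saVec_ne_zero hI (hJ.mono Finset.subset_union_left) hIJK hU) (saVec_union I J K)
    (isValid_saVec _ _) (isValid_mmiVec hIJ hIK hJK) (isValid_saVec _ _) ?_ ?_
  · obtain ⟨x, hx⟩ := hI
    obtain ⟨y, hy⟩ := hJ
    obtain ⟨z, hz⟩ := hK
    obtain ⟨u, hu⟩ : ∃ u, u ∉ I ∪ (J ∪ K) := by simpa [Finset.eq_univ_iff_forall] using hU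
    simp only [Finset.mem_union, not_or] at hu
    have hxJ := Finset.disjoint_left.1 hIJ hx
    have hzJ := Finset.disjoint_right.1 hJK hz
    rw [dotProduct_single_one]
    simp only [saVec, Pi.add_apply, Pi.sub_apply]
    rw [entry_apply_eq_zero (B := I) hr x u (by simp [hx, hxJ]) (by simp [hu]),
      entry_apply_eq_zero (B := J ∪ K) hr z y (by simp [hz, hzJ]) (by simp [hy]),
      entry_apply_eq_zero (B := I ∪ (J ∪ K)) hr x y (by simp [hx, hxJ]) (by simp [hy])]
    norm_num
  · rw [dotProduct_single_one, saVec_comm, saVec_apply_left hJ hI hIJ.symm hU']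
    exact one_ne_zero

theorem IsSubadditivity.isSingletonSA_or_exists_union {n : ℕ} {q : SVec n}
    (hq : IsSubadditivity q) : IsSingletonSA q ∨ ∃ I J K : Finset (ExtTerminal n),
      I.Nonempty ∧ J.Nonempty ∧ K.Nonempty ∧ Disjoint I J ∧ Disjoint I K ∧ Disjoint J K ∧
        I ∪ (J ∪ K) ≠ Finset.univ ∧ q = saVec I (J ∪ K) := by
  obtain ⟨I, J, hI, hJ, hIJ, hU, rfl⟩ := hq
  have split : ∀ I J : Finset (ExtTerminal n), I.Nonempty → J.Nontrivial → Disjoint I J →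
      I ∪ J ≠ Finset.univ → ∃ I' J' K : Finset (ExtTerminal n),
      I'.Nonempty ∧ J'.Nonempty ∧ K.Nonempty ∧ Disjoint I' J' ∧ Disjoint I' K ∧ Disjoint J' K ∧
        I' ∪ (J' ∪ K) ≠ Finset.univ ∧ saVec I J = saVec I' (J' ∪ K) := by
    intro I J hI hJ hIJ hU
    obtain ⟨x, hx⟩ := hJ.nonempty
    have hJ' : {x} ∪ J.erase x = J := Finset.insert_erase hx
    refine ⟨I, {x}, J.erase x, hI, Finset.singleton_nonempty x, hJ.erase_nonempty,
      Finset.disjoint_of_subset_right (by simpa using hx) hIJ,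
      Finset.disjoint_of_subset_right (Finset.erase_subset _ _) hIJ, by simp, ?_, ?_⟩
    · rwa [hJ']
    · rw [hJ']
  rcases hI.exists_eq_singleton_or_nontrivial with ⟨i, rfl⟩ | hI'
  · rcases hJ.exists_eq_singleton_or_nontrivial with ⟨j, rfl⟩ | hJ'
    · exact Or.inl ⟨i, j, by simpa using hIJ, rfl⟩
    · exact Or.inr (split _ _ hI hJ' hIJ hU)
  · rw [saVec_comm]
    exact Or.inr (split _ _ hJ hI' hIJ.symm (by rwa [Finset.union_comm]))

end HolographicEntropy

theorem proposition4p8 (n : ℕ) (hn : 2 ≤ n) (m : ℕ)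
    (q : HolographicEntropy.SVec m) (hq : HolographicEntropy.IsSubadditivity q)
    (q' : HolographicEntropy.SVec n) (hq' : HolographicEntropy.IsZeroLift q q') :
    (HolographicEntropy.IsFacet q' ↔ HolographicEntropy.IsSingletonSA q') ∧
    (¬ HolographicEntropy.IsSingletonSA q' →
      ∃ I J K : Finset (HolographicEntropy.ExtTerminal n),
        I.Nonempty ∧ J.Nonempty ∧ K.Nonempty ∧
        Disjoint I J ∧ Disjoint I K ∧ Disjoint J K ∧ I ∪ J ∪ K ≠ Finset.univ ∧
        HolographicEntropy.IsValid (HolographicEntropy.saVec I J) ∧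
        HolographicEntropy.IsValid (HolographicEntropy.mmiVec I J K) ∧
        HolographicEntropy.IsValid (HolographicEntropy.saVec I K) ∧
        q' = HolographicEntropy.saVec I J + HolographicEntropy.mmiVec I J K
          + HolographicEntropy.saVec I K) := by
  have h := hq.of_isZeroLift hq' |>.isSingletonSA_or_exists_union
  refine ⟨⟨fun hf => ?_, ?_⟩, fun hs => ?_⟩
  · rcases h with h | ⟨I, J, K, hI, hJ, hK, hIJ, hIK, hJK, hU, rfl⟩
    · exact h
    · exact absurd hf (HolographicEntropy.not_isFacet_saVec_union hI hJ hK hIJ hIK hJK hU)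
  · rintro ⟨i, j, hij, rfl⟩
    exact HolographicEntropy.isFacet_saVec_singleton hn hij
  · obtain ⟨I, J, K, hI, hJ, hK, hIJ, hIK, hJK, hU, rfl⟩ := h.resolve_left hs
    exact ⟨I, J, K, hI, hJ, hK, hIJ, hIK, hJK, by rwa [Finset.union_assoc],
      HolographicEntropy.isValid_saVec _ _, HolographicEntropy.isValid_mmiVec hIJ hIK hJK,
      HolographicEntropy.isValid_saVec _ _, HolographicEntropy.saVec_union I J K⟩
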